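/- Let $\kappa$ be a regular cardinal (so $\kappa$ is infinite) and let $\mathsf{C}$ be a small category with $\kappa$-small colimits, i.e. with colimits of all diagrams indexed by categories with fewer than $\kappa$ morphisms. Let $\mathrm{Ind}_\kappa(\mathsf{C})$ be the free completion of $\mathsf{C}$ under small $\kappa$-filtered colimits, i.e. the full subcategory of $[\mathsf{C}^{\mathrm{op}},\mathsf{Set}]$ on the presheaves that are colimits of small $\kappa$-filtered diagrams of representable presheaves. Then the following are equivalent: 1. $\mathsf{C}$ is weakly regular: for every commutative square $g f' = f g'$ in $\mathsf{C}$, with $f' : W \to D$, $g' : W \to A$, $f : A \to B$, $g : D \to B$ and $f$ a regular epimorphism, there are an object $\bar W$, morphisms $\bar f : \bar W \to D$ and $\bar g : \bar W \to A$ with $g\bar f = f\bar g$ and $\bar f$ a regular epimorphism, and a morphism $t : W \to \bar W$ with $\bar f t = f'$ and $\bar g t = g'$. 2. $\mathrm{Ind}_\kappa(\mathsf{C})$ is regular: it has finite limits, every kernel pair in it has a coequalizer, and the pullback of a regular epimorphism along any morphism is a regular epimorphism. Here a regular epimorphism is a morphism that is a coequalizer of some pair of parallel morphisms. -/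

import Mathlib

universe w v u

namespace WeaklyRegularInd

open CategoryTheory CategoryTheory.Limits Opposite


/-- A category has `κ`-small colimits if it has colimits of all shapes given by small categories
with fewer than `κ` morphisms. -/
def HasCardinalSmallColimits (C : Type u) [Category.{v} C] (κ : Cardinal.{w}) : Prop :=
  ∀ (J : Type w) [SmallCategory J], HasCardinalLT (Arrow J) κ → HasColimitsOfShape J C

/-- A category is weakly regular if every commutative square
```
  W --f'--> D
  |         |
  g'        g
  v         v
  A --f --> B
```
in which `f` is a regular epimorphism factors, through some `t : W ⟶ W₁`, through a commutative
square on the same cospan whose top side `f₁ : W₁ ⟶ D` is a regular epimorphism. -/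
def IsWeaklyRegular (C : Type u) [Category.{v} C] : Prop :=
  ∀ ⦃W D A B : C⦄ (f' : W ⟶ D) (g' : W ⟶ A) (f : A ⟶ B) (g : D ⟶ B),
    IsRegularEpi f → f' ≫ g = g' ≫ f →
      ∃ (W₁ : C) (f₁ : W₁ ⟶ D) (g₁ : W₁ ⟶ A) (t : W ⟶ W₁),
        IsRegularEpi f₁ ∧ f₁ ≫ g = g₁ ≫ f ∧ t ≫ f₁ = f' ∧ t ≫ g₁ = g'

/-- A presheaf on a small category is a `κ`-ind-object if it is the colimit, in the category of
presheaves, of a small `κ`-filtered diagram of representable presheaves. -/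
def isCardinalIndObject (C : Type w) [SmallCategory C] (κ : Cardinal.{w}) [Fact κ.IsRegular] :
    ObjectProperty (Cᵒᵖ ⥤ Type w) := fun A =>
  ∃ (J : Type w) (_ : SmallCategory J) (_ : IsCardinalFiltered J κ) (F : J ⥤ C)
    (ι : F ⋙ yoneda ⟶ (Functor.const J).obj A), Nonempty (IsColimit (Cocone.mk A ι))

/-- The free completion `Ind_κ(C)` of a small category `C` under small `κ`-filtered colimits: the
full subcategory of presheaves on `C` consisting of the `κ`-ind-objects. -/
abbrev CardinalInd (C : Type w) [SmallCategory C] (κ : Cardinal.{w}) [Fact κ.IsRegular] :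
    Type (w + 1) :=
  (isCardinalIndObject C κ).FullSubcategory

end WeaklyRegularInd

namespace WeaklyRegularInd

open CategoryTheory Limits Opposite

/-! Because `C` has `κ`-small colimits, the `κ`-ind-objects are the presheaves that turn these
colimits into limits (`isCardinalIndObject_iff`). Hence `Ind_κ(C)` has finite limits, and a family
of elements closed under restriction and `κ`-small colimits is a subobject (`exists_mono`).

If `C` is weakly regular, its regular epimorphisms act as covers. The elements of the target that
lift along `f` after a cover form a subobject, the closure under colimits being
`isRegularEpi_sigmaDesc`. So every morphism is locally surjective followed by mono (`exists_image`);
regular epimorphisms coincide with locally surjective morphisms, which are visibly stable under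
pullback.

Conversely, form the pullback of `f` and `g` in `Ind_κ(C)`. Its projection to `D` is already
strongly epic on one representable `V` (`exists_strongEpi`), and remains so on `W ⨿ V`, through
which the given square factors. The Yoneda embedding reflects regular epimorphisms, so this square
is as required. -/

/-- A presheaf `A` is `κ`-continuous if every compatible family of maps to `A` from the
representables of a `κ`-small diagram extends uniquely to the representable of its colimit. -/
def IsCardinalContinuous {C : Type w} [SmallCategory C] (κ : Cardinal.{w})
    (A : Cᵒᵖ ⥤ Type w) : Prop :=
  ∀ ⦃J : Type w⦄ [SmallCategory J], HasCardinalLT (Arrow J) κ → ∀ (G : J ⥤ C) (c : Cocone G),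
    IsColimit c → ∀ x : (∀ j, yoneda.obj (G.obj j) ⟶ A),
      (∀ ⦃j k : J⦄ (φ : j ⟶ k), yoneda.map (G.map φ) ≫ x k = x j) →
        ∃! y : yoneda.obj c.pt ⟶ A, ∀ j, yoneda.map (c.ι.app j) ≫ y = x j

/-! ### Ind-objects as continuous presheaves -/

section

variable {C : Type w} [SmallCategory C] {κ : Cardinal.{w}}

theorem IsCardinalContinuous.of_isLimit {I : Type*} [Category* I] {F : I ⥤ Cᵒᵖ ⥤ Type w}
    {s : Cone F} (hs : IsLimit s) (hF : ∀ i, IsCardinalContinuous κ (F.obj i)) :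
    IsCardinalContinuous κ s.pt := by
  intro J _ hJ G c hc x hx
  have h (i : I) := hF i hJ G c hc (fun j ↦ x j ≫ s.π.app i) fun j k φ ↦ by
    rw [← hx φ, Category.assoc]
  choose y hy hy' using h
  have hy'' (i : I) (z) (hz : ∀ j, yoneda.map (c.ι.app j) ≫ z = x j ≫ s.π.app i) :
      z = y i := hy' i z hz
  refine ⟨hs.lift ⟨_, ⟨y, fun i i' φ ↦ ?_⟩⟩, fun j ↦ hs.hom_ext fun i ↦ ?_,
    fun z hz ↦ hs.hom_ext fun i ↦ ?_⟩
  · dsimp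
    rw [Category.id_comp]
    refine (hy'' i' _ fun j ↦ ?_).symm
    have := hy i j
    dsimp at this
    rw [reassoc_of% this, s.w]
  · rw [Category.assoc, hs.fac]
    exact hy i j
  · rw [hs.fac]
    refine hy'' i _ fun j ↦ ?_
    rw [← hz j, Category.assoc]

variable [Fact κ.IsRegular]

theorem isCardinalFiltered_costructuredArrow {A : Cᵒᵖ ⥤ Type w}
    (hA : isCardinalIndObject C κ A) :
    IsCardinalFiltered (CostructuredArrow yoneda A) κ := by
  obtain ⟨J, _, _, F, ι, ⟨h⟩⟩ := hA
  have := isFiltered_of_isCardinalFiltered J κ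
  let P := IndObjectPresentation.ofCocone ⟨A, ι⟩ h
  have : IsCardinalFiltered P.I κ := ‹IsCardinalFiltered J κ›
  exact IsCardinalFiltered.of_final P.toCostructuredArrow κ

theorem isCardinalIndObject_of_isCardinalFiltered (A : Cᵒᵖ ⥤ Type w)
    [IsCardinalFiltered (CostructuredArrow yoneda A) κ] : isCardinalIndObject C κ A :=
  ⟨CostructuredArrow yoneda A, inferInstance, inferInstance, CostructuredArrow.proj _ _, _,
    ⟨Presheaf.isColimitTautologicalCocone A⟩⟩

/-- A compatible family is a `κ`-small diagram in the `κ`-filtered category of elements of `A`. A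
cocone on it gives the extension; coequalizing the comparison maps of two extensions gives
uniqueness. -/
theorem isCardinalContinuous_of_isCardinalIndObject {A : Cᵒᵖ ⥤ Type w}
    (hA : isCardinalIndObject C κ A) : IsCardinalContinuous κ A := by
  have := isCardinalFiltered_costructuredArrow hA
  have := isFiltered_of_isCardinalFiltered (CostructuredArrow yoneda A) κ
  intro J _ hJ G c hc x hx
  let F : J ⥤ CostructuredArrow yoneda A :=
    { obj j := CostructuredArrow.mk (x j)
      map φ := CostructuredArrow.homMk (G.map φ) (hx φ) }
  let s := IsCardinalFiltered.cocone F hJ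
  let d : c.pt ⟶ s.pt.left := hc.desc ⟨s.pt.left, ⟨fun j ↦ (s.ι.app j).left, fun j k φ ↦ 
    (congr_arg CommaMorphism.left (s.w φ)).trans (Category.comp_id _).symm⟩⟩
  refine existsUnique_of_exists_of_unique ⟨yoneda.map d ≫ s.pt.hom, fun j ↦ ?_⟩
    fun y y' hy hy' ↦ ?_
  · rw [← Functor.map_comp_assoc, hc.fac]
    exact CostructuredArrow.w (s.ι.app j)
  · let a := CostructuredArrow.mk y
    let a' := CostructuredArrow.mk y'
    let u := IsFiltered.leftToMax a a'
    let v := IsFiltered.rightToMax a a'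
    let i (j : J) : F.obj j ⟶ a := CostructuredArrow.homMk (c.ι.app j) (hy j)
    let i' (j : J) : F.obj j ⟶ a' := CostructuredArrow.homMk (c.ι.app j) (hy' j)
    obtain ⟨b, t, ht⟩ := IsCardinalFiltered.multicoequalizer (fun j ↦ i j ≫ u)
      (fun j ↦ i' j ≫ v) (hasCardinalLT_of_hasCardinalLT_arrow hJ)
    have huv : (u ≫ t).left = (v ≫ t).left := hc.hom_ext fun j ↦ by
      simpa [i, i'] using congr_arg CommaMorphism.left (ht j)
    exact (CostructuredArrow.w (u ≫ t)).symm.trans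
      (by rw [huv]; exact CostructuredArrow.w (v ≫ t))

theorem isCardinalIndObject_iff (hC : HasCardinalSmallColimits.{w, w, w} C κ)
    {A : Cᵒᵖ ⥤ Type w} : isCardinalIndObject C κ A ↔ IsCardinalContinuous κ A := by
  refine ⟨isCardinalContinuous_of_isCardinalIndObject, fun h ↦ ?_⟩
  suffices IsCardinalFiltered (CostructuredArrow yoneda A) κ from
    isCardinalIndObject_of_isCardinalFiltered A
  -- A cocone on a `κ`-small diagram of elements is obtained by taking the colimit in `C` and
  -- extending the elements to it by continuity.
  refine ⟨fun {J} _ F hJ ↦ ?_⟩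
  have := hC J hJ
  let G := F ⋙ CostructuredArrow.proj _ _
  obtain ⟨y, hy, -⟩ := h hJ G _ (colimit.isColimit G) (fun j ↦ (F.obj j).hom)
    fun j k φ ↦ CostructuredArrow.w (F.map φ)
  exact ⟨⟨CostructuredArrow.mk y,
    { app j := CostructuredArrow.homMk (colimit.ι G j) (hy j)
      naturality j k φ := by
        ext
        exact (colimit.w G φ).trans (Category.comp_id _).symm }⟩⟩

/-- A family of maps from representables to `B` that is stable under precomposition, as a
subfunctor of `B`. -/
def subfunctorOfSieve {B : Cᵒᵖ ⥤ Type w} (S : ∀ Y : C, Set (yoneda.obj Y ⟶ B))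
    (hS : ∀ ⦃X Y : C⦄ (f : X ⟶ Y), ∀ x ∈ S Y, yoneda.map f ≫ x ∈ S X) : Subfunctor B where
  obj U := {x | yonedaEquiv.symm x ∈ S U.unop}
  map {U V} i x hx := by
    have := hS i.unop _ hx
    rwa [yonedaEquiv_symm_naturality_left] at this

theorem exists_comp_subfunctorOfSieve_ι_iff {B : Cᵒᵖ ⥤ Type w}
    (S : ∀ Y : C, Set (yoneda.obj Y ⟶ B))
    (hS : ∀ ⦃X Y : C⦄ (f : X ⟶ Y), ∀ x ∈ S Y, yoneda.map f ≫ x ∈ S X) {Y : C}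
    (x : yoneda.obj Y ⟶ B) :
    (∃ z, z ≫ (subfunctorOfSieve S hS).ι = x) ↔ x ∈ S Y := by
  constructor
  · rintro ⟨z, rfl⟩
    have := (yonedaEquiv z).2
    change yonedaEquiv.symm _ ∈ S Y at this
    convert! this
    apply yonedaEquiv.injective
    rw [Equiv.apply_symm_apply, yonedaEquiv_comp]
    rfl
  · intro hx
    have hx' : yonedaEquiv x ∈ (subfunctorOfSieve S hS).obj (op Y) := by
      change yonedaEquiv.symm _ ∈ S Y
      simpa using hx
    let z : (subfunctorOfSieve S hS).toFunctor.obj (op Y) := ⟨yonedaEquiv x, hx'⟩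
    refine ⟨yonedaEquiv.symm z, yonedaEquiv.injective ?_⟩
    rw [yonedaEquiv_comp, Equiv.apply_symm_apply]
    rfl

end

/-! ### Maps out of representables, finite limits and subobjects -/

namespace CardinalInd

variable {C : Type w} [SmallCategory C] {κ : Cardinal.{w}} [Fact κ.IsRegular]

variable (C κ) in
/-- The Yoneda embedding with values in `κ`-ind-objects. -/
def yoneda : C ⥤ CardinalInd C κ :=
  (isCardinalIndObject C κ).lift CategoryTheory.yoneda fun X ↦
    have : IsCardinalFiltered (CostructuredArrow CategoryTheory.yoneda
        (CategoryTheory.yoneda.obj X)) κ :=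
      CostructuredArrow.mkIdTerminal.isCardinalFiltered κ
    isCardinalIndObject_of_isCardinalFiltered _

instance : (yoneda C κ).Full := inferInstanceAs (ObjectProperty.lift _ _ _).Full

instance : (yoneda C κ).Faithful := inferInstanceAs (ObjectProperty.lift _ _ _).Faithful

theorem hom_ext {A B : CardinalInd C κ} {f g : A ⟶ B}
    (h : ∀ (Y : C) (x : (yoneda C κ).obj Y ⟶ A), x ≫ f = x ≫ g) : f = g := by
  ext : 1
  refine (Presheaf.isColimitTautologicalCocone A.obj).hom_ext fun j ↦ ?_
  exact congr_arg (·.hom) (h j.left (ObjectProperty.homMk j.hom))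

theorem exists_hom {A B : CardinalInd C κ}
    (φ : ∀ Y : C, ((yoneda C κ).obj Y ⟶ A) → ((yoneda C κ).obj Y ⟶ B))
    (hφ : ∀ ⦃X Y : C⦄ (f : X ⟶ Y) (x : (yoneda C κ).obj Y ⟶ A),
      φ X ((yoneda C κ).map f ≫ x) = (yoneda C κ).map f ≫ φ Y x) :
    ∃ f : A ⟶ B, ∀ (Y : C) (x : (yoneda C κ).obj Y ⟶ A), x ≫ f = φ Y x := by
  let s : Cocone (CostructuredArrow.proj CategoryTheory.yoneda A.obj ⋙ CategoryTheory.yoneda) :=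
    { pt := B.obj
      ι :=
        { app j := (φ j.left (ObjectProperty.homMk j.hom)).hom
          naturality j k t := by
            refine Eq.trans ?_ (Category.comp_id _).symm
            have h := congr_arg (·.hom) (hφ t.left (ObjectProperty.homMk k.hom))
            refine h.symm.trans ?_
            congr 2
            ext : 1
            exact CostructuredArrow.w t } }
  refine ⟨ObjectProperty.homMk ((Presheaf.isColimitTautologicalCocone A.obj).desc s),
    fun Y x ↦ ?_⟩
  ext : 1
  exact (Presheaf.isColimitTautologicalCocone A.obj).fac s (CostructuredArrow.mk x.hom)

/-- A morphism all of whose restrictions to representables factor through a monomorphism factors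
through it. -/
theorem exists_lift_of_mono {A B I : CardinalInd C κ} (f : A ⟶ B) (m : I ⟶ B) [Mono m]
    (h : ∀ (Y : C) (x : (yoneda C κ).obj Y ⟶ A), ∃ z, z ≫ m = x ≫ f) : ∃ g, g ≫ m = f := by
  choose φ hφ using h
  obtain ⟨g, hg⟩ := exists_hom φ fun X Y t x ↦ by
    rw [← cancel_mono m, Category.assoc, hφ, hφ, Category.assoc]
  exact ⟨g, hom_ext fun Y x ↦ by rw [reassoc_of% (hg Y x), hφ]⟩

/-- A compatible family of maps from the representables of a diagram extends uniquely to the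
representable of a `κ`-small colimit. -/
theorem existsUnique_desc {A : CardinalInd C κ} {J : Type w} [SmallCategory J]
    (hJ : HasCardinalLT (Arrow J) κ) {G : J ⥤ C} {c : Cocone G} (hc : IsColimit c)
    (x : ∀ j, (yoneda C κ).obj (G.obj j) ⟶ A)
    (hx : ∀ ⦃j k : J⦄ (φ : j ⟶ k), (yoneda C κ).map (G.map φ) ≫ x k = x j) :
    ∃! y : (yoneda C κ).obj c.pt ⟶ A, ∀ j, (yoneda C κ).map (c.ι.app j) ≫ y = x j := by
  obtain ⟨y, hy, hy'⟩ := isCardinalContinuous_of_isCardinalIndObject A.property hJ G c hc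
    (fun j ↦ (x j).hom) fun j k φ ↦ congr_arg (·.hom) (hx φ)
  refine ⟨ObjectProperty.homMk y, fun j ↦ ?_, fun z hz ↦ ?_⟩
  · ext : 1
    exact hy j
  · ext : 1
    exact hy' _ fun j ↦ congr_arg (·.hom) (hz j)

theorem existsUnique_sigmaDesc {A : CardinalInd C κ} {ι : Type w} (hι : HasCardinalLT ι κ)
    (X : ι → C) [HasCoproduct X] (x : ∀ i, (yoneda C κ).obj (X i) ⟶ A) :
    ∃! y : (yoneda C κ).obj (∐ X) ⟶ A, ∀ i, (yoneda C κ).map (Sigma.ι X i) ≫ y = x i := by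
  obtain ⟨y, hy, hy'⟩ := existsUnique_desc (J := Discrete ι) (by simpa using hι)
    (colimit.isColimit (Discrete.functor X)) (fun i ↦ x i.as) (by
      rintro ⟨i⟩ ⟨j⟩ φ
      obtain rfl : i = j := Discrete.eq_of_hom φ
      obtain rfl : φ = 𝟙 _ := Subsingleton.elim _ _
      simp)
  exact ⟨y, fun i ↦ hy ⟨i⟩, fun z hz ↦ hy' z fun i ↦ hz i.as⟩

theorem preservesColimitsOfShape_yoneda {J : Type w} [SmallCategory J]
    (hJ : HasCardinalLT (Arrow J) κ) : PreservesColimitsOfShape J (yoneda C κ) where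
  preservesColimit {G} := ⟨fun {c} hc ↦ by
    have h (s : Cocone (G ⋙ yoneda C κ)) := existsUnique_desc hJ hc s.ι.app fun j k φ ↦ s.w φ
    choose d hd hd' using fun s ↦ (h s)
    exact ⟨⟨d, hd, fun s m hm ↦ hd' s m hm⟩⟩⟩

theorem hasFiniteColimits (hC : HasCardinalSmallColimits.{w, w, w} C κ) :
    HasFiniteColimits C :=
  hasFiniteColimits_of_hasFiniteColimits_of_size C fun J _ _ ↦
    hC J (.of_le (by rw [hasCardinalLT_aleph0_iff]; infer_instance)
      (Cardinal.IsRegular.aleph0_le Fact.out))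

theorem preservesFiniteColimits_yoneda : PreservesFiniteColimits (yoneda C κ) :=
  preservesFiniteColimits_of_preservesFiniteColimitsOfSize.{w} _ fun _ _ _ ↦
    preservesColimitsOfShape_yoneda
      (.of_le (by rw [hasCardinalLT_aleph0_iff]; infer_instance)
        (Cardinal.IsRegular.aleph0_le Fact.out))

theorem isRegularEpi_map_yoneda {X Y : C} (f : X ⟶ Y) (hf : IsRegularEpi f) :
    IsRegularEpi ((yoneda C κ).map f) := by
  have := preservesFiniteColimits_yoneda (C := C) (κ := κ)
  have r := IsRegularEpi.getStruct f
  exact ⟨⟨⟨_, _, _, by rw [← Functor.map_comp, r.w, Functor.map_comp],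
    isColimitCoforkMapOfIsColimit _ _ r.isColimit⟩⟩⟩

theorem hasFiniteLimits (hC : HasCardinalSmallColimits.{w, w, w} C κ) :
    HasFiniteLimits (CardinalInd C κ) where
  out J _ _ := by
    have : (isCardinalIndObject C κ).IsClosedUnderLimitsOfShape J := ⟨by
      rintro A ⟨p⟩
      rw [isCardinalIndObject_iff hC]
      exact .of_isLimit p.isLimit fun j ↦
        (isCardinalIndObject_iff hC).1 (p.prop_diag_obj j)⟩
    infer_instance

/-- A family of maps from representables to `B` that is stable under precomposition and under
`κ`-small colimits consists of the maps which factor through some monomorphism. -/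
theorem exists_mono (hC : HasCardinalSmallColimits.{w, w, w} C κ) {B : CardinalInd C κ}
    (S : ∀ Y : C, Set ((yoneda C κ).obj Y ⟶ B))
    (hS : ∀ ⦃X Y : C⦄ (f : X ⟶ Y), ∀ x ∈ S Y, (yoneda C κ).map f ≫ x ∈ S X)
    (hS' : ∀ ⦃J : Type w⦄ [SmallCategory J], HasCardinalLT (Arrow J) κ → ∀ (G : J ⥤ C)
      (c : Cocone G), IsColimit c → ∀ x : (yoneda C κ).obj c.pt ⟶ B,
        (∀ j, (yoneda C κ).map (c.ι.app j) ≫ x ∈ S (G.obj j)) → x ∈ S c.pt) :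
    ∃ (I : CardinalInd C κ) (m : I ⟶ B), Mono m ∧
      ∀ (Y : C) (x : (yoneda C κ).obj Y ⟶ B), (∃ z, z ≫ m = x) ↔ x ∈ S Y := by
  let S₀ (Y : C) : Set (CategoryTheory.yoneda.obj Y ⟶ B.obj) :=
    {x | (ObjectProperty.homMk x : (yoneda C κ).obj Y ⟶ B) ∈ S Y}
  have hS₀ : ∀ ⦃X Y : C⦄ (f : X ⟶ Y), ∀ x ∈ S₀ Y, CategoryTheory.yoneda.map f ≫ x ∈ S₀ X :=
    fun X Y f x hx ↦ hS f _ hx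
  let I := (subfunctorOfSieve S₀ hS₀).toFunctor
  let m : I ⟶ B.obj := (subfunctorOfSieve S₀ hS₀).ι
  have hm {Y : C} (x) := exists_comp_subfunctorOfSieve_ι_iff S₀ hS₀ (Y := Y) x
  have hI : isCardinalIndObject C κ I := by
    rw [isCardinalIndObject_iff hC]
    intro J _ hJ G c hc x hx
    -- The family is glued in `B`; closure of `S` under colimits puts the result back in the
    -- subpresheaf.
    obtain ⟨y, hy, hy'⟩ := isCardinalContinuous_of_isCardinalIndObject B.property hJ G c hc
      (fun j ↦ x j ≫ m) fun j k φ ↦ by rw [← hx φ, Category.assoc]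
    obtain ⟨z, rfl⟩ := (hm y).2 (hS' hJ G c hc (ObjectProperty.homMk y) fun j ↦
      (hm (CategoryTheory.yoneda.map (c.ι.app j) ≫ y)).1 ⟨x j, (hy j).symm⟩)
    refine ⟨z, fun j ↦ ?_, fun z' hz' ↦ ?_⟩
    · rw [← cancel_mono m, Category.assoc]
      exact hy j
    · rw [← cancel_mono m]
      exact hy' _ fun j ↦ by rw [reassoc_of% hz']
  refine ⟨⟨I, hI⟩, ObjectProperty.homMk m,
    (isCardinalIndObject C κ).ι.mono_of_mono_map (inferInstanceAs (Mono m)), fun Y x ↦ ?_⟩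
  refine Iff.trans ⟨?_, ?_⟩ (hm x.hom)
  · rintro ⟨z, rfl⟩
    exact ⟨z.hom, rfl⟩
  · rintro ⟨z, hz⟩
    exact ⟨ObjectProperty.homMk z, by ext : 1; exact hz⟩

/-- A `κ`-filtered diagram of representables has a cocone under which maps from representables
behave as for a `κ`-filtered colimit. -/
theorem exists_cocone {J : Type w} [SmallCategory J] [IsCardinalFiltered J κ] (F : J ⥤ C) :
    ∃ c : Cocone (F ⋙ yoneda C κ),
      (∀ (Y : C) (x : (yoneda C κ).obj Y ⟶ c.pt), ∃ (j : J) (f : Y ⟶ F.obj j),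
        (yoneda C κ).map f ≫ c.ι.app j = x) ∧
      ∀ (Y : C) (j : J) (f g : Y ⟶ F.obj j),
        (yoneda C κ).map f ≫ c.ι.app j = (yoneda C κ).map g ≫ c.ι.app j →
          ∃ (k : J) (t : j ⟶ k), f ≫ F.map t = g ≫ F.map t := by
  have := isFiltered_of_isCardinalFiltered J κ
  let s := colimit.cocone (F ⋙ CategoryTheory.yoneda)
  have hs : IsColimit s := colimit.isColimit _
  let X : CardinalInd C κ := ⟨s.pt, J, inferInstance, inferInstance, F, s.ι, ⟨hs⟩⟩
  have hs' (Y : C) := isColimitOfPreserves ((evaluation Cᵒᵖ (Type w)).obj (op Y)) hs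
  refine ⟨⟨X, ⟨fun j ↦ ObjectProperty.homMk (s.ι.app j), fun j k φ ↦ ?_⟩⟩, fun Y x ↦ ?_,
    fun Y j f g h ↦ ?_⟩
  · ext : 1
    exact s.ι.naturality φ
  · obtain ⟨j, f, hf⟩ := Types.jointly_surjective_of_isColimit (hs' Y) (yonedaEquiv x.hom)
    refine ⟨j, f, ?_⟩
    ext : 1
    apply yonedaEquiv.injective
    rw [← hf]
    exact yonedaEquiv_comp (CategoryTheory.yoneda.map f) (s.ι.app j) |>.trans
      (congr_arg _ (yonedaEquiv_yoneda_map f))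
  · have h' : ((evaluation Cᵒᵖ (Type w)).obj (op Y)).map (s.ι.app j) f =
        ((evaluation Cᵒᵖ (Type w)).obj (op Y)).map (s.ι.app j) g := by
      have := congr_arg (fun t ↦ yonedaEquiv t.hom) h
      refine Eq.trans ?_ (this.trans ?_)
      · exact (yonedaEquiv_comp (CategoryTheory.yoneda.map f) (s.ι.app j) |>.trans
          (congr_arg _ (yonedaEquiv_yoneda_map f))).symm
      · exact yonedaEquiv_comp (CategoryTheory.yoneda.map g) (s.ι.app j) |>.trans
          (congr_arg _ (yonedaEquiv_yoneda_map g))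
    exact (Types.FilteredColimit.isColimit_eq_iff' (hs' Y) f g).1 h'

end CardinalInd

/-! ### Weak regularity of `C` implies regularity of the completion -/

section

variable {C : Type w} [SmallCategory C] {κ : Cardinal.{w}}

/-- Any cospan is completed to a commutative square by the initial object, to which weak regularity
applies. -/
theorem IsWeaklyRegular.exists_square [HasInitial C] (h : IsWeaklyRegular.{w, w} C) {A B D : C}
    (f : A ⟶ B) (g : D ⟶ B) (hf : IsRegularEpi f) :
    ∃ (W : C) (f₁ : W ⟶ D) (g₁ : W ⟶ A), IsRegularEpi f₁ ∧ f₁ ≫ g = g₁ ≫ f := by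
  obtain ⟨W, f₁, g₁, -, h₁, h₂, -⟩ :=
    h (initial.to D) (initial.to A) f g hf (initialIsInitial.hom_ext _ _)
  exact ⟨W, f₁, g₁, h₁, h₂⟩

/-- An epimorphism that is the joint coequalizer of a `κ`-small family of parallel pairs is a
regular epimorphism. -/
theorem isRegularEpi_of_family (hC : HasCardinalSmallColimits.{w, w, w} C κ) {A B : C}
    (f : A ⟶ B) [Epi f] {ι : Type w} (hι : HasCardinalLT ι κ) (R : ι → C)
    (r s : ∀ i, R i ⟶ A) (w : ∀ i, r i ≫ f = s i ≫ f)
    (h : ∀ ⦃Z : C⦄ (g : A ⟶ Z), (∀ i, r i ≫ g = s i ≫ g) → ∃ u, f ≫ u = g) :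
    IsRegularEpi f := by
  have := hC (Discrete ι) (by simpa using hι)
  have w' : Sigma.desc r ≫ f = Sigma.desc s ≫ f := Sigma.hom_ext _ _ fun i ↦ by simp [w]
  refine ⟨⟨⟨_, Sigma.desc r, Sigma.desc s, w', Cofork.IsColimit.mk' _ fun t ↦ ?_⟩⟩⟩
  choose u hu using h t.π fun i ↦ by simpa using Sigma.ι R i ≫= t.condition
  refine ⟨u, hu, fun hm ↦ ?_⟩
  rwa [← cancel_epi f, hu]

variable [Fact κ.IsRegular]

/-- In a weakly regular category, regular epimorphisms onto the objects of a `κ`-small diagram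
induce a regular epimorphism onto its colimit. -/
theorem IsWeaklyRegular.isRegularEpi_sigmaDesc (hC : HasCardinalSmallColimits.{w, w, w} C κ)
    [HasInitial C] (h : IsWeaklyRegular.{w, w} C) {J : Type w} [SmallCategory J]
    (hJ : HasCardinalLT (Arrow J) κ) {G : J ⥤ C} {c : Cocone G} (hc : IsColimit c)
    (X : J → C) [HasColimitsOfShape (Discrete J) C] (q : ∀ j, X j ⟶ G.obj j)
    (hq : ∀ j, IsRegularEpi (q j)) :
    IsRegularEpi (Sigma.desc fun j ↦ q j ≫ c.ι.app j) := by
  -- The relations on `∐ X` are of two kinds: pairs with coequalizer `q j`, and for each arrow of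
  -- `J` a square identifying its two ends. As `t φ` is epic, the latter suffice to make the
  -- descended maps a cocone.
  choose T t s ht hts using fun φ : Arrow J ↦
    h.exists_square (q φ.right) (q φ.left ≫ G.map φ.hom) (hq φ.right)
  have : Epi (Sigma.desc fun j ↦ q j ≫ c.ι.app j) := ⟨fun a b hab ↦ hc.hom_ext fun j ↦ by
    rw [← cancel_epi (q j)]
    simpa using Sigma.ι X j ≫= hab⟩
  refine isRegularEpi_of_family hC _ (ι := J ⊕ Arrow J)
    ((hasCardinalLT_sum_iff _ _ _ (Cardinal.IsRegular.aleph0_le Fact.out)).2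
      ⟨hasCardinalLT_of_hasCardinalLT_arrow hJ, hJ⟩)
    (Sum.elim (fun j ↦ IsRegularEpi.W (q j)) T)
    (Sum.rec (fun j ↦ IsRegularEpi.left (q j) ≫ Sigma.ι X j) fun φ ↦ t φ ≫ Sigma.ι X φ.left)
    (Sum.rec (fun j ↦ IsRegularEpi.right (q j) ≫ Sigma.ι X j) fun φ ↦ s φ ≫ Sigma.ι X φ.right)
    ?_ ?_
  · rintro (j | φ)
    · simp [reassoc_of% (IsRegularEpi.w (q j))]
    · dsimp
      rw [Category.assoc, Category.assoc, Sigma.ι_desc, Sigma.ι_desc, ← reassoc_of% (hts φ),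
        c.w φ.hom]
  · intro Z g hg
    have hd (j : J) : ∃ d : G.obj j ⟶ Z, q j ≫ d = Sigma.ι X j ≫ g :=
      ⟨_, IsRegularEpi.fac (q j) (Sigma.ι X j ≫ g) (by simpa using hg (.inl j))⟩
    choose d hd using hd
    refine ⟨hc.desc ⟨Z, ⟨d, fun j k φ ↦ ?_⟩⟩, Sigma.hom_ext _ _ fun j ↦ by simp [hd]⟩
    have := ht (Arrow.mk φ)
    refine Eq.trans ?_ (Category.comp_id _).symm
    rw [← cancel_epi (q j), ← cancel_epi (t (Arrow.mk φ))]
    have h₁ := hts (Arrow.mk φ)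
    have h₂ := hg (.inr (Arrow.mk φ))
    dsimp at h₁ h₂ ⊢
    simp only [Category.assoc] at h₁ h₂
    rw [reassoc_of% h₁, hd, hd, h₂]

namespace CardinalInd

/-- A morphism of `κ`-ind-objects is locally surjective if every element of the target lifts to
the source after restriction along some regular epimorphism in `C`. -/
def IsLocallySurjective {A B : CardinalInd C κ} (f : A ⟶ B) : Prop :=
  ∀ ⦃Y : C⦄ (x : (yoneda C κ).obj Y ⟶ B), ∃ (X : C) (q : X ⟶ Y)
    (a : (yoneda C κ).obj X ⟶ A), IsRegularEpi q ∧ a ≫ f = (yoneda C κ).map q ≫ x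

theorem IsLocallySurjective.of_isPullback {P A B D : CardinalInd C κ} {fst : P ⟶ A}
    {snd : P ⟶ D} {f : A ⟶ B} {g : D ⟶ B} (sq : IsPullback fst snd f g)
    (hf : IsLocallySurjective f) : IsLocallySurjective snd := fun Y x ↦ by
  obtain ⟨X, q, a, hq, ha⟩ := hf (x ≫ g)
  exact ⟨X, q, sq.lift a ((yoneda C κ).map q ≫ x) (by simpa using ha), hq, by simp⟩

/-- If `g` coequalizes the kernel pair of `f`, an element of the target is sent to the descent of
`g` applied to a local lift. Weak regularity compares any two lifts on a common cover, giving
independence and naturality. -/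
theorem IsLocallySurjective.isRegularEpi [HasInitial C] [HasPullbacks (CardinalInd C κ)]
    (h : IsWeaklyRegular.{w, w} C) {A B : CardinalInd C κ} {f : A ⟶ B}
    (hf : IsLocallySurjective f) : IsRegularEpi f := by
  have : Epi f := ⟨fun g₁ g₂ hg ↦ hom_ext fun Y x ↦ by
    obtain ⟨X, q, a, hq, ha⟩ := hf x
    have := isRegularEpi_map_yoneda (κ := κ) q hq
    rw [← cancel_epi ((yoneda C κ).map q), ← reassoc_of% ha, ← reassoc_of% ha, hg]⟩
  refine IsRegularEpi.of_epi_of_exists fun Z g hg ↦ ?_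
  have hg' {T : CardinalInd C κ} (u v : T ⟶ A) (huv : u ≫ f = v ≫ f) : u ≫ g = v ≫ g := by
    simpa only [pullback.lift_fst_assoc, pullback.lift_snd_assoc] using
      pullback.lift u v huv ≫= hg
  have key (Y : C) (x : (yoneda C κ).obj Y ⟶ B) : ∃ z : (yoneda C κ).obj Y ⟶ Z,
      ∀ (T : C) (t : T ⟶ Y) (a : (yoneda C κ).obj T ⟶ A), a ≫ f = (yoneda C κ).map t ≫ x →
        (yoneda C κ).map t ≫ z = a ≫ g := by
    obtain ⟨X, q, a, hq, ha⟩ := hf x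
    have := isRegularEpi_map_yoneda (κ := κ) q hq
    obtain ⟨z, hz⟩ : ∃ z, (yoneda C κ).map q ≫ z = a ≫ g :=
      ⟨_, EffectiveEpi.fac ((yoneda C κ).map q) (a ≫ g) fun u v huv ↦ by
        simpa using hg' (u ≫ a) (v ≫ a)
          (by rw [Category.assoc, Category.assoc, ha, reassoc_of% huv])⟩
    refine ⟨z, fun T t b hb ↦ ?_⟩
    obtain ⟨W, q', t', hq', hW⟩ := h.exists_square q t hq
    have := isRegularEpi_map_yoneda (κ := κ) q' hq'
    rw [← cancel_epi ((yoneda C κ).map q'), ← Functor.map_comp_assoc, hW,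
      Functor.map_comp_assoc, hz]
    simpa using hg' ((yoneda C κ).map t' ≫ a) ((yoneda C κ).map q' ≫ b) (by
      rw [Category.assoc, Category.assoc, ha, hb, ← Functor.map_comp_assoc,
        ← Functor.map_comp_assoc, hW])
  choose φ hφ using key
  obtain ⟨u, hu⟩ := exists_hom φ fun X Y s x ↦ by
    obtain ⟨T, q, a, hq, ha⟩ := hf ((yoneda C κ).map s ≫ x)
    have := isRegularEpi_map_yoneda (κ := κ) q hq
    rw [← cancel_epi ((yoneda C κ).map q), hφ _ _ _ q a ha, ← Functor.map_comp_assoc,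
      hφ _ _ _ (q ≫ s) a (by simpa using ha)]
  refine ⟨u, hom_ext fun Y a ↦ ?_⟩
  rw [← Category.assoc, hu]
  simpa using hφ Y (a ≫ f) Y (𝟙 Y) a (by simp)

/-- In the presence of weak regularity, every morphism of `κ`-ind-objects factors as a locally
surjective morphism followed by a monomorphism. -/
theorem exists_image (hC : HasCardinalSmallColimits.{w, w, w} C κ)
    [HasInitial C] (h : IsWeaklyRegular.{w, w} C) {A B : CardinalInd C κ} (f : A ⟶ B) :
    ∃ (I : CardinalInd C κ) (e : A ⟶ I) (m : I ⟶ B),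
      IsLocallySurjective e ∧ Mono m ∧ e ≫ m = f := by
  obtain ⟨I, m, _, hm⟩ := exists_mono hC
    (fun Y ↦ {x : (yoneda C κ).obj Y ⟶ B | ∃ (X : C) (q : X ⟶ Y)
      (a : (yoneda C κ).obj X ⟶ A), IsRegularEpi q ∧ a ≫ f = (yoneda C κ).map q ≫ x})
    (by
      rintro X Y s x ⟨T, q, a, hq, ha⟩
      obtain ⟨W, q', s', hq', hW⟩ := h.exists_square q s hq
      exact ⟨W, q', (yoneda C κ).map s' ≫ a, hq', by
        rw [Category.assoc, ha, ← Functor.map_comp_assoc, ← Functor.map_comp_assoc, hW]⟩)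
    (by
      intro J _ hJ G c hc x hx
      choose X q a hq ha using hx
      have hJ' := hasCardinalLT_of_hasCardinalLT_arrow hJ
      have := hC (Discrete J) (by simpa using hJ')
      obtain ⟨b, hb, -⟩ := existsUnique_sigmaDesc hJ' X a
      refine ⟨_, _, b, h.isRegularEpi_sigmaDesc hC hJ hc X q hq, ?_⟩
      refine (existsUnique_sigmaDesc hJ' X fun j ↦ a j ≫ f).unique (fun j ↦ ?_) fun j ↦ ?_
      · rw [← Category.assoc, hb]
      · rw [← Functor.map_comp_assoc, Sigma.ι_desc, Functor.map_comp_assoc, ha])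
  obtain ⟨e, rfl⟩ := exists_lift_of_mono f m fun Y x ↦
    (hm _ _).2 ⟨Y, 𝟙 Y, x, inferInstance, by simp⟩
  refine ⟨I, e, m, fun Y x ↦ ?_, inferInstance, rfl⟩
  obtain ⟨X, q, a, hq, ha⟩ := (hm _ _).1 ⟨x, rfl⟩
  exact ⟨X, q, a, hq, by rw [← cancel_mono m]; simpa using ha⟩

theorem isLocallySurjective_of_isRegularEpi (hC : HasCardinalSmallColimits.{w, w, w} C κ)
    [HasInitial C] (h : IsWeaklyRegular.{w, w} C) {A B : CardinalInd C κ} (f : A ⟶ B)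
    [IsRegularEpi f] : IsLocallySurjective f := by
  obtain ⟨I, e, m, he, _, hem⟩ := exists_image hC h f
  -- The mono part of a strong epimorphism is invertible, so `f` inherits local surjectivity from
  -- `e`.
  have : StrongEpi (e ≫ m) := by rw [hem]; infer_instance
  have := strongEpi_of_strongEpi e m
  have := isIso_of_mono_of_strongEpi m
  intro Y x
  obtain ⟨X, q, a, hq, ha⟩ := he (x ≫ inv m)
  exact ⟨X, q, a, hq, by rw [← hem, reassoc_of% ha]; simp⟩

theorem regular_of_isWeaklyRegular (hC : HasCardinalSmallColimits.{w, w, w} C κ)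
    (h : IsWeaklyRegular.{w, w} C) : Regular (CardinalInd C κ) := by
  have := hasFiniteColimits hC
  have := hasFiniteLimits hC
  refine { hasCoequalizer_of_isKernelPair := ?_, regularEpiIsStableUnderBaseChange := ⟨?_⟩ }
  · intro X Y Z f g₁ g₂ hk
    obtain ⟨I, e, m, he, _, rfl⟩ := exists_image hC h f
    have := he.isRegularEpi h
    have hk' : IsKernelPair e g₁ g₂ := hk.cancel_right_of_mono
    exact ⟨⟨_, hk'.toCoequalizer'⟩⟩
  · intro X Y Y' S f g f' g' sq hg
    have : IsRegularEpi g := hg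
    exact ((isLocallySurjective_of_isRegularEpi hC h g).of_isPullback sq).isRegularEpi h

end CardinalInd

end

/-! ### Regularity of the completion implies weak regularity of `C` -/

namespace CardinalInd

variable {C : Type w} [SmallCategory C] {κ : Cardinal.{w}} [Fact κ.IsRegular]

/-- The Yoneda embedding into `κ`-ind-objects reflects regular epimorphisms. -/
theorem isRegularEpi_of_isRegularEpi_map_yoneda [HasCoequalizers C]
    [HasPullbacks (CardinalInd C κ)] {A B : C} (f : A ⟶ B)
    [IsRegularEpi ((yoneda C κ).map f)] : IsRegularEpi f := by
  let R := pullback ((yoneda C κ).map f) ((yoneda C κ).map f)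
  let J := CostructuredArrow CategoryTheory.yoneda R.obj
  have : IsCardinalFiltered J κ := isCardinalFiltered_costructuredArrow R.property
  have := isFiltered_of_isCardinalFiltered J κ
  have hepi : Epi f := (yoneda C κ).epi_of_epi_map inferInstance
  let x (j : J) : (yoneda C κ).obj j.left ⟶ R := ObjectProperty.homMk j.hom
  have hx {j k : J} (φ : j ⟶ k) : (yoneda C κ).map φ.left ≫ x k = x j := by
    apply InducedCategory.hom_ext
    exact CostructuredArrow.w φ
  choose u hu using fun j : J ↦ (yoneda C κ).map_surjective (x j ≫ pullback.fst _ _)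
  choose v hv using fun j : J ↦ (yoneda C κ).map_surjective (x j ≫ pullback.snd _ _)
  have hu' {j k : J} (φ : j ⟶ k) : φ.left ≫ u k = u j := (yoneda C κ).map_injective (by
    rw [Functor.map_comp, hu, hu, reassoc_of% (hx φ)])
  have hv' {j k : J} (φ : j ⟶ k) : φ.left ≫ v k = v j := (yoneda C κ).map_injective (by
    rw [Functor.map_comp, hv, hv, reassoc_of% (hx φ)])
  have huv (j : J) : u j ≫ f = v j ≫ f := (yoneda C κ).map_injective (by
    rw [Functor.map_comp, Functor.map_comp, hu, hv, Category.assoc, Category.assoc,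
      pullback.condition])
  -- The kernel pair of the image of `f` is a `κ`-filtered colimit of pairs `u j`, `v j` in `C`; `F`
  -- collects their coequalizers.
  let F : J ⥤ C :=
    { obj j := coequalizer (u j) (v j)
      map {j k} φ := coequalizer.desc (coequalizer.π (u k) (v k)) (by
        rw [← hu' φ, ← hv' φ, Category.assoc, Category.assoc, coequalizer.condition])
      map_id j := by ext; simp
      map_comp φ ψ := by ext; simp }
  let π (j : J) : A ⟶ F.obj j := coequalizer.π (u j) (v j)
  have hπ {j k : J} (φ : j ⟶ k) : π j ≫ F.map φ = π k := coequalizer.π_desc _ _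
  obtain ⟨c, hc, hc'⟩ := exists_cocone (κ := κ) F
  let p (j : J) : (yoneda C κ).obj A ⟶ c.pt := (yoneda C κ).map (π j) ≫ c.ι.app j
  have hp {j k : J} (φ : j ⟶ k) : p j = p k := by
    dsimp only [p]
    rw [← hπ φ, Functor.map_comp_assoc]
    exact congr_arg _ (c.w φ).symm
  have hp' (j k : J) : p j = p k :=
    (hp (IsFiltered.leftToMax j k)).trans (hp (IsFiltered.rightToMax j k)).symm
  obtain ⟨j₀⟩ := IsFiltered.nonempty (C := J)
  obtain ⟨s, hs⟩ := IsRegularEpi.exists_of_isKernelPair ((yoneda C κ).map f)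
    (IsKernelPair.of_hasPullback _) (p j₀) (hom_ext fun Y y ↦ by
      let j : J := CostructuredArrow.mk y.hom
      have hj : (yoneda C κ).map (u j) ≫ p j = (yoneda C κ).map (v j) ≫ p j := by
        dsimp only [p]
        rw [← Functor.map_comp_assoc, ← Functor.map_comp_assoc, coequalizer.condition]
      rw [hu, hv, Category.assoc, Category.assoc, hp' j j₀] at hj
      exact hj)
  obtain ⟨j, t, rfl⟩ := hc B s
  obtain ⟨k, φ, hk⟩ := hc' A j (f ≫ t) (π j) (by
    rw [Functor.map_comp_assoc, hs]
    exact hp' _ _)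
  rw [hπ, Category.assoc] at hk
  refine ⟨⟨⟨_, u k, v k, huv k, Cofork.IsColimit.mk' _ fun s ↦
    ⟨t ≫ F.map φ ≫ coequalizer.desc s.π s.condition, ?_, fun {m} hm ↦ ?_⟩⟩⟩⟩
  · refine Eq.trans ?_ (coequalizer.π_desc s.π s.condition)
    exact (by simp : f ≫ t ≫ F.map φ ≫ coequalizer.desc s.π s.condition =
      (f ≫ t ≫ F.map φ) ≫ coequalizer.desc s.π s.condition).trans (by rw [hk])
  · rw [← cancel_epi f]
    refine hm.trans (Eq.trans ?_ (by simp : (f ≫ t ≫ F.map φ) ≫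
      coequalizer.desc s.π s.condition = f ≫ t ≫ F.map φ ≫ _))
    rw [hk]
    exact (coequalizer.π_desc s.π s.condition).symm

/-- If `κ`-ind-objects form a regular category, a regular epimorphism onto a representable is
already a strong epimorphism when restricted to some representable. -/
theorem exists_strongEpi (hC : HasCardinalSmallColimits.{w, w, w} C κ)
    [Regular (CardinalInd C κ)] {P : CardinalInd C κ} {D : C} (e : P ⟶ (yoneda C κ).obj D)
    [IsRegularEpi e] : ∃ (V : C) (p : (yoneda C κ).obj V ⟶ P), StrongEpi (p ≫ e) := by
  obtain ⟨U, m, _, hm⟩ := exists_mono hC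
    (fun Y ↦ {x : (yoneda C κ).obj Y ⟶ (yoneda C κ).obj D |
      ∃ (V : C) (p : (yoneda C κ).obj V ⟶ P), ∃ z, z ≫ image.ι (p ≫ e) = x})
    (by
      rintro X Y f x ⟨V, p, z, rfl⟩
      exact ⟨V, p, (yoneda C κ).map f ≫ z, Category.assoc _ _ _⟩)
    (by
      intro J _ hJ G c hc x hx
      choose V p z hz using hx
      have hJ' := hasCardinalLT_of_hasCardinalLT_arrow hJ
      have := hC (Discrete J) (by simpa using hJ')
      -- The image of the coproduct of the `V j` contains the image of each, so one representable
      -- serves the whole diagram.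
      obtain ⟨q, hq, -⟩ := existsUnique_sigmaDesc hJ' V p
      have hz' (j : J) : ∃ y : (yoneda C κ).obj (G.obj j) ⟶ image (q ≫ e),
          y ≫ image.ι (q ≫ e) = (yoneda C κ).map (c.ι.app j) ≫ x := by
        have sq : CommSq ((yoneda C κ).map (Sigma.ι V j) ≫ factorThruImage (q ≫ e))
            (factorThruImage (p j ≫ e)) (image.ι (q ≫ e)) (image.ι (p j ≫ e)) :=
          ⟨by simp [reassoc_of% (hq j)]⟩
        exact ⟨z j ≫ sq.lift, by rw [Category.assoc, sq.fac_right, hz]⟩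
      choose y hy using hz'
      obtain ⟨d, hd, -⟩ := existsUnique_desc hJ hc y fun j k φ ↦ by
        rw [← cancel_mono (image.ι (q ≫ e)), Category.assoc, hy, hy, ← Functor.map_comp_assoc,
          c.w]
      refine ⟨_, q, d, (existsUnique_desc hJ hc (fun j ↦ (yoneda C κ).map (c.ι.app j) ≫ x)
        fun j k φ ↦ ?_).unique (fun j ↦ ?_) fun j ↦ rfl⟩
      · rw [← Functor.map_comp_assoc, c.w]
      · rw [reassoc_of% (hd j), hy])
  obtain ⟨e', rfl⟩ := exists_lift_of_mono e m fun Y x ↦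
    (hm _ _).2 ⟨Y, x, factorThruImage _, image.fac _⟩
  have := strongEpi_of_strongEpi e' m
  have := isIso_of_mono_of_strongEpi m
  -- As `m` is invertible, the identity of `D` belongs to the family, so the image inclusion for
  -- some `V` is split epic.
  obtain ⟨V, p, z, hz⟩ := (hm D (𝟙 _)).1 ⟨inv m, by simp⟩
  have : IsSplitEpi (image.ι (p ≫ e' ≫ m)) := ⟨⟨⟨z, hz⟩⟩⟩
  refine ⟨V, p, ?_⟩
  rw [← image.fac (p ≫ e' ≫ m)]
  exact strongEpi_comp _ _

theorem isWeaklyRegular_of_regular (hC : HasCardinalSmallColimits.{w, w, w} C κ)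
    [Regular (CardinalInd C κ)] : IsWeaklyRegular.{w, w} C := by
  have := hasFiniteColimits hC
  intro W D A B f' g' f g hf hw
  have := isRegularEpi_map_yoneda (κ := κ) f hf
  let y := yoneda C κ
  let P := pullback (y.map g) (y.map f)
  have : IsRegularEpi (pullback.fst (y.map g) (y.map f)) := inferInstance
  obtain ⟨V, p, hp⟩ := exists_strongEpi hC (pullback.fst (y.map g) (y.map f))
  let p₀ : y.obj W ⟶ P := pullback.lift (y.map f') (y.map g') (by
    rw [← Functor.map_comp, ← Functor.map_comp, hw])
  have := preservesFiniteColimits_yoneda (C := C) (κ := κ)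
  obtain ⟨q, hq₀, hq⟩ : ∃ q : y.obj (W ⨿ V) ⟶ P,
      y.map coprod.inl ≫ q = p₀ ∧ y.map coprod.inr ≫ q = p := by
    obtain ⟨q, hq₀, hq⟩ := BinaryCofan.IsColimit.desc'
      (isColimitOfHasBinaryCoproductOfPreservesColimit y W V) p₀ p
    exact ⟨q, hq₀, hq⟩
  have : StrongEpi (y.map coprod.inr ≫ q ≫ pullback.fst (y.map g) (y.map f)) := by
    rwa [reassoc_of% hq]
  have := strongEpi_of_strongEpi (y.map coprod.inr) (q ≫ pullback.fst (y.map g) (y.map f))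
  obtain ⟨f₁, hf₁⟩ := y.map_surjective (q ≫ pullback.fst (y.map g) (y.map f))
  obtain ⟨g₁, hg₁⟩ := y.map_surjective (q ≫ pullback.snd (y.map g) (y.map f))
  have : IsRegularEpi (y.map f₁) := by
    rw [hf₁]
    infer_instance
  refine ⟨W ⨿ V, f₁, g₁, coprod.inl, isRegularEpi_of_isRegularEpi_map_yoneda (κ := κ) f₁,
    y.map_injective ?_, y.map_injective ?_, y.map_injective ?_⟩
  · rw [Functor.map_comp, Functor.map_comp, hf₁, hg₁, Category.assoc, Category.assoc,
      pullback.condition]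
  · rw [Functor.map_comp, hf₁, reassoc_of% hq₀]
    exact pullback.lift_fst _ _ _
  · rw [Functor.map_comp, hg₁, reassoc_of% hq₀]
    exact pullback.lift_snd _ _ _

end CardinalInd

end WeaklyRegularInd

theorem mainTheorem8 (κ : Cardinal.{w}) [Fact κ.IsRegular]
    (C : Type w) [CategoryTheory.SmallCategory.{w} C]
    (hC : WeaklyRegularInd.HasCardinalSmallColimits.{w, w, w} C κ) :
    WeaklyRegularInd.IsWeaklyRegular.{w, w} C ↔
      CategoryTheory.Regular.{w + 1, w} (WeaklyRegularInd.CardinalInd.{w} C κ) :=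
  ⟨WeaklyRegularInd.CardinalInd.regular_of_isWeaklyRegular hC,
    fun _ ↦ WeaklyRegularInd.CardinalInd.isWeaklyRegular_of_regular hC⟩
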